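/- Let $\mathcal K$ be an infinite-dimensional separable complex Hilbert space (inner product conjugate-linear in the first variable) equipped with a complex conjugation $k\mapsto k^*$, i.e. an antilinear isometric involution. Let $\mathcal C(\mathcal K)$ be the selfdual CAR algebra over $\mathcal K$: the universal C*-algebra generated by $\mathbf 1$ and the elements of $\mathcal K$ (with the linear structure of $\mathcal K$, and with the conjugation $k\mapsto k^*$ as the involution on $\mathcal K$), subject to $$k^*k'+k'k^*=\langle k,k'\rangle\mathbf 1,\qquad k,k'\in\mathcal K .$$ View $\mathcal K$ as a subspace of $\mathcal C(\mathcal K)$. For an isometry $V$ on $\mathcal K$ that commutes with the conjugation, let $\varrho_V$ be the Bogoliubov endomorphism induced by $V$, i.e. the unique unital *-endomorphism of $\mathcal C(\mathcal K)$ with $\varrho_V(k)=Vk$ for all $k\in\mathcal K$. Let $\gamma=\varrho_{-\mathbf 1}$, and let $\mathcal C(\mathcal K)_0=\{a\in\mathcal C(\mathcal K):\gamma(a)=a\}$ be the even subalgebra. **Proposition.** Let $V$ be an isometry on $\mathcal K$ that commutes with the complex conjugation and is a Fredholm operator of index $\operatorname{ind}V=\dim\ker V-\dim\ker V^*=-\dim\ker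 V^*=-1$. Let $k_V\in\ker V^*$ be unitary and skew-adjoint as an element of $\mathcal C(\mathcal K)$. Then $u_V:=\frac1{\sqrt2}(\mathbf 1+k_V)\in\mathcal C(\mathcal K)$ is unitary, and $$\sigma_V(a):=u_V\,\varrho_V(a)\,u_V^*,\qquad a\in\mathcal C(\mathcal K),$$ defines a unital *-isomorphism $\sigma_V$ from $\mathcal C(\mathcal K)$ onto its even subalgebra $\mathcal C(\mathcal K)_0$. -/

import Mathlib

universe u v

/-! ### The conjugate opposite algebra

It is used only to build conjugate-linear anti-homomorphisms out of algebra homomorphisms. -/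

/-- The opposite ring of `A`, on which a scalar `c` acts as its conjugate. -/
def ConjOp (A : Type v) : Type v := Aᵐᵒᵖ

noncomputable instance ConjOp.instRing (A : Type v) [Ring A] : Ring (ConjOp A) :=
  inferInstanceAs (Ring Aᵐᵒᵖ)

noncomputable instance ConjOp.instAlgebra (A : Type v) [Ring A] [Algebra ℂ A] :
    Algebra ℂ (ConjOp A) :=
  Algebra.compHom Aᵐᵒᵖ (starRingEnd ℂ)

/-- The tautological conjugate-linear map `A → ConjOp A`. -/
def ConjOp.of {A : Type v} (a : A) : ConjOp A := MulOpposite.op a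

/-- The tautological conjugate-linear map `ConjOp A → A`. -/
def ConjOp.val {A : Type v} (a : ConjOp A) : A := MulOpposite.unop a

theorem ConjOp.val_mul {A : Type v} [Ring A] (a b : ConjOp A) : (a * b).val = b.val * a.val := rfl

theorem ConjOp.val_add {A : Type v} [Ring A] (a b : ConjOp A) : (a + b).val = a.val + b.val := rfl

theorem ConjOp.val_one {A : Type v} [Ring A] : (1 : ConjOp A).val = 1 := rfl

theorem ConjOp.val_smul {A : Type v} [Ring A] [Algebra ℂ A] (c : ℂ) (a : ConjOp A) :
    (c • a).val = (starRingEnd ℂ) c • a.val := rfl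

theorem ConjOp.val_injective {A : Type v} : Function.Injective (ConjOp.val : ConjOp A → A) :=
  MulOpposite.unop_injective

/-! ### C*-seminorms -/

/-- A C*-seminorm on a complex *-algebra. -/
structure CStarSeminorm (A : Type v) [Ring A] [Algebra ℂ A] [StarRing A] extends
    Seminorm ℂ A where
  mul_le' : ∀ a b : A, toFun (a * b) ≤ toFun a * toFun b
  star_mul_self' : ∀ a : A, toFun (star a * a) = toFun a * toFun a

/-! ### Complex conjugations, and linear maps satisfying the CAR

A complex conjugation on a complex Hilbert space `K`, i.e. an antilinear isometric involution
`k ↦ star k`, is given by the classes `StarAddMonoid K`, `StarModule ℂ K`, `NormedStarGroup K`. -/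

/-- `φ : K → B` is a linear map into a complex *-algebra which intertwines the complex conjugation
with the involution and satisfies the (selfdual) canonical anticommutation relations
`φ(k)* φ(k') + φ(k') φ(k)* = ⟨k, k'⟩ 1`. -/
structure IsCARMap {K : Type u} [NormedAddCommGroup K] [InnerProductSpace ℂ K] [StarAddMonoid K]
    {B : Type v} [Ring B] [Algebra ℂ B] [StarRing B] (φ : K →ₗ[ℂ] B) : Prop where
  map_star : ∀ k : K, φ (star k) = star (φ k)
  anticomm : ∀ k k' : K, star (φ k) * φ k' + φ k' * star (φ k) = (inner ℂ k k') • (1 : B)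

/-! ### The algebraic selfdual CAR algebra -/

/-- The defining relations `k* k' + k' k* = ⟨k, k'⟩ 1` on the tensor algebra of `K`. -/
inductive CARRel (K : Type u) [NormedAddCommGroup K] [InnerProductSpace ℂ K] [StarAddMonoid K] :
    TensorAlgebra ℂ K → TensorAlgebra ℂ K → Prop
  | anticomm (k k' : K) :
      CARRel K
        (TensorAlgebra.ι ℂ (star k) * TensorAlgebra.ι ℂ k' +
          TensorAlgebra.ι ℂ k' * TensorAlgebra.ι ℂ (star k))
        ((inner ℂ k k') • (1 : TensorAlgebra ℂ K))

/-- The unital complex *-algebra generated by the linear space `K` subject to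
`k* k' + k' k* = ⟨k, k'⟩ 1`; the C*-algebra is obtained from it by completion. -/
def AlgCAR (K : Type u) [NormedAddCommGroup K] [InnerProductSpace ℂ K] [StarAddMonoid K] :
    Type u :=
  RingQuot (CARRel K)

namespace AlgCAR

section Basic

variable (K : Type u) [NormedAddCommGroup K] [InnerProductSpace ℂ K] [StarAddMonoid K]

noncomputable instance instRing : Ring (AlgCAR K) := inferInstanceAs (Ring (RingQuot (CARRel K)))

noncomputable instance instAlgebra : Algebra ℂ (AlgCAR K) :=
  inferInstanceAs (Algebra ℂ (RingQuot (CARRel K)))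

/-- The canonical map from `K` to the algebraic CAR algebra. -/
noncomputable def ι : K →ₗ[ℂ] AlgCAR K :=
  (RingQuot.mkAlgHom ℂ (CARRel K)).toLinearMap ∘ₗ TensorAlgebra.ι ℂ

variable {K}

theorem ι_anticomm (k k' : K) :
    ι K (star k) * ι K k' + ι K k' * ι K (star k) = (inner ℂ k k') • (1 : AlgCAR K) := by
  have h := RingQuot.mkAlgHom_rel ℂ (CARRel.anticomm k k')
  rw [map_add, map_mul, map_mul, map_smul, map_one] at h
  exact h

/-- The universal property of the underlying algebra. -/
noncomputable def liftAlg {B : Type v} [Ring B] [Algebra ℂ B] (φ : K →ₗ[ℂ] B)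
    (h : ∀ k k' : K, φ (star k) * φ k' + φ k' * φ (star k) = (inner ℂ k k') • (1 : B)) :
    AlgCAR K →ₐ[ℂ] B :=
  RingQuot.liftAlgHom ℂ ⟨TensorAlgebra.lift ℂ φ, by
    rintro _ _ ⟨k, k'⟩
    simp only [map_add, map_mul, map_smul, map_one, TensorAlgebra.lift_ι_apply]
    exact h k k'⟩

theorem liftAlg_ι {B : Type v} [Ring B] [Algebra ℂ B] (φ : K →ₗ[ℂ] B)
    (h : ∀ k k' : K, φ (star k) * φ k' + φ k' * φ (star k) = (inner ℂ k k') • (1 : B)) (k : K) :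
    liftAlg φ h (ι K k) = φ k := by
  have h1 := RingQuot.liftAlgHom_mkAlgHom_apply ℂ (TensorAlgebra.lift ℂ φ) (s := CARRel K) (by
    rintro _ _ ⟨k, k'⟩
    simp only [map_add, map_mul, map_smul, map_one, TensorAlgebra.lift_ι_apply]
    exact h k k') (TensorAlgebra.ι ℂ k)
  rw [TensorAlgebra.lift_ι_apply] at h1
  exact h1

theorem induction {P : AlgCAR K → Prop} (hc : ∀ c : ℂ, P (algebraMap ℂ _ c))
    (hι : ∀ k, P (ι K k)) (hmul : ∀ a b, P a → P b → P (a * b))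
    (hadd : ∀ a b, P a → P b → P (a + b)) (a : AlgCAR K) : P a := by
  obtain ⟨t, rfl⟩ := RingQuot.mkAlgHom_surjective ℂ (CARRel K) a
  induction t using TensorAlgebra.induction with
  | algebraMap r => rw [AlgHom.commutes]; exact hc r
  | ι x => exact hι x
  | mul a b ha hb => rw [map_mul]; exact hmul _ _ ha hb
  | add a b ha hb => rw [map_add]; exact hadd _ _ ha hb

end Basic

section Star

variable {K : Type u} [NormedAddCommGroup K] [InnerProductSpace ℂ K] [StarAddMonoid K]
  [StarModule ℂ K]

/-- The linear map `k ↦ star k` from `K` to the conjugate opposite algebra. -/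
noncomputable def starι : K →ₗ[ℂ] ConjOp (AlgCAR K) where
  toFun k := ConjOp.of (ι K (star k))
  map_add' a b := by
    apply ConjOp.val_injective
    change ι K (star (a + b)) = ι K (star a) + ι K (star b)
    rw [star_add, map_add]
  map_smul' c a := by
    apply ConjOp.val_injective
    change ι K (star (c • a)) = (starRingEnd ℂ) c • ι K (star a)
    rw [star_smul, map_smul]
    rfl

/-- The involution, as an algebra homomorphism to the conjugate opposite algebra. -/
noncomputable def starHom : AlgCAR K →ₐ[ℂ] ConjOp (AlgCAR K) :=
  liftAlg starι (by
    intro k k'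
    apply ConjOp.val_injective
    rw [ConjOp.val_add, ConjOp.val_mul, ConjOp.val_mul, ConjOp.val_smul, ConjOp.val_one]
    change ι K (star k') * ι K (star (star k)) + ι K (star (star k)) * ι K (star k') = _
    rw [star_star, ι_anticomm, inner_conj_symm])

noncomputable instance instStar : Star (AlgCAR K) := ⟨fun a => (starHom a).val⟩

theorem star_def (a : AlgCAR K) : star a = (starHom a).val := rfl

theorem star_ι (k : K) : star (ι K k) = ι K (star k) := by
  rw [star_def, starHom, liftAlg_ι]
  rfl

theorem star_mul_aux (a b : AlgCAR K) : star (a * b) = star b * star a := by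
  rw [star_def, map_mul, ConjOp.val_mul]
  rfl

theorem star_add_aux (a b : AlgCAR K) : star (a + b) = star a + star b := by
  rw [star_def, map_add, ConjOp.val_add]
  rfl

theorem star_smul_aux (c : ℂ) (a : AlgCAR K) : star (c • a) = (starRingEnd ℂ) c • star a := by
  rw [star_def, map_smul, ConjOp.val_smul]
  rfl

theorem star_algebraMap_aux (c : ℂ) :
    star (algebraMap ℂ (AlgCAR K) c) = algebraMap ℂ (AlgCAR K) ((starRingEnd ℂ) c) := by
  rw [Algebra.algebraMap_eq_smul_one, star_smul_aux, star_def, map_one, ConjOp.val_one,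
    Algebra.algebraMap_eq_smul_one]

noncomputable instance instStarRing : StarRing (AlgCAR K) where
  star_involutive a := by
    induction a using AlgCAR.induction with
    | hc c => rw [star_algebraMap_aux, star_algebraMap_aux, Complex.conj_conj]
    | hι k => rw [star_ι, star_ι, star_star]
    | hmul a b ha hb => rw [star_mul_aux, star_mul_aux, ha, hb]
    | hadd a b ha hb => rw [star_add_aux, star_add_aux, ha, hb]
  star_mul := star_mul_aux
  star_add := star_add_aux

instance instStarModule : StarModule ℂ (AlgCAR K) := ⟨star_smul_aux⟩

/-- The universal property of the *-algebra. -/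
noncomputable def lift {B : Type v} [Ring B] [Algebra ℂ B] [StarRing B] [StarModule ℂ B]
    (φ : K →ₗ[ℂ] B) (h : IsCARMap φ) : AlgCAR K →⋆ₐ[ℂ] B where
  toAlgHom := liftAlg φ (by
    intro k k'
    rw [h.map_star]
    exact h.anticomm k k')
  map_star' a := by
    change liftAlg φ _ (star a) = star (liftAlg φ _ a)
    induction a using AlgCAR.induction with
    | hc c =>
      rw [star_algebraMap_aux, AlgHom.commutes, AlgHom.commutes, Algebra.algebraMap_eq_smul_one,
        Algebra.algebraMap_eq_smul_one, star_smul, star_one]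
      rfl
    | hι k => rw [star_ι, liftAlg_ι, liftAlg_ι, h.map_star]
    | hmul a b ha hb => rw [star_mul, map_mul, map_mul, star_mul, ha, hb]
    | hadd a b ha hb => rw [star_add, map_add, map_add, star_add, ha, hb]

theorem lift_ι {B : Type v} [Ring B] [Algebra ℂ B] [StarRing B] [StarModule ℂ B]
    (φ : K →ₗ[ℂ] B) (h : IsCARMap φ) (k : K) : lift φ h (ι K k) = φ k :=
  liftAlg_ι φ (fun k k' => by rw [h.map_star]; exact h.anticomm k k') k

end Star

section Norm

variable {K : Type u} [NormedAddCommGroup K] [InnerProductSpace ℂ K] [StarAddMonoid K]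
  [StarModule ℂ K]

theorem seminorm_one_le (p : CStarSeminorm (AlgCAR K)) : p.toSeminorm 1 ≤ 1 := by
  have h : p.toSeminorm (star 1 * 1) = p.toSeminorm 1 * p.toSeminorm 1 := p.star_mul_self' 1
  rw [star_one, one_mul] at h
  nlinarith [sq_nonneg (p.toSeminorm 1 - 1)]

theorem seminorm_ι_le_of_isSelfAdjoint (p : CStarSeminorm (AlgCAR K)) (k : K) (hk : star k = k) :
    p.toSeminorm (ι K k) ≤ ‖k‖ := by
  have h : p.toSeminorm (star (ι K k) * ι K k) = p.toSeminorm (ι K k) * p.toSeminorm (ι K k) :=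
    p.star_mul_self' _
  have h2 : (2 : ℂ) • (star (ι K k) * ι K k) = (inner ℂ k k) • (1 : AlgCAR K) := by
    rw [← ι_anticomm, star_ι, hk, two_smul]
  have h3 := congrArg p.toSeminorm h2
  rw [map_smul_eq_mul, map_smul_eq_mul, h, inner_self_eq_norm_sq_to_K] at h3
  norm_num at h3
  have h4 := mul_le_mul_of_nonneg_left (seminorm_one_le p) (sq_nonneg ‖k‖)
  have h5 : 0 ≤ p.toSeminorm (ι K k) := apply_nonneg _ _
  nlinarith [norm_nonneg k, sq_nonneg ‖k‖]

theorem exists_seminorm_bound (a : AlgCAR K) :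
    ∃ C : ℝ, ∀ p : CStarSeminorm (AlgCAR K), p.toSeminorm a ≤ C := by
  induction a using AlgCAR.induction with
  | hc c =>
    refine ⟨‖c‖, fun p => ?_⟩
    rw [Algebra.algebraMap_eq_smul_one, map_smul_eq_mul]
    exact mul_le_of_le_one_right (norm_nonneg c) (seminorm_one_le p)
  | hι k =>
    set x : K := k + star k with hx
    set y : K := Complex.I • (k - star k) with hy
    have hxs : star x = x := by rw [hx, star_add, star_star, add_comm]
    have hys : star y = y := by
      rw [hy, star_smul, star_sub, star_star]
      simp only [Complex.star_def, Complex.conj_I, neg_smul, smul_sub]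
      abel
    have hk : k = (2⁻¹ : ℂ) • x + (-(2⁻¹ : ℂ) * Complex.I) • y := by
      rw [hx, hy, smul_smul, mul_assoc, Complex.I_mul_I]
      module
    refine ⟨‖(2⁻¹ : ℂ)‖ * ‖x‖ + ‖-(2⁻¹ : ℂ) * Complex.I‖ * ‖y‖, fun p => ?_⟩
    rw [hk, map_add, map_smul, map_smul]
    refine (map_add_le_add p.toSeminorm _ _).trans ?_
    rw [map_smul_eq_mul, map_smul_eq_mul]
    exact add_le_add
      (mul_le_mul_of_nonneg_left (seminorm_ι_le_of_isSelfAdjoint p x hxs) (norm_nonneg _))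
      (mul_le_mul_of_nonneg_left (seminorm_ι_le_of_isSelfAdjoint p y hys) (norm_nonneg _))
  | hmul a b ha hb =>
    obtain ⟨C, hC⟩ := ha
    obtain ⟨D, hD⟩ := hb
    refine ⟨C * D, fun p => (p.mul_le' a b).trans ?_⟩
    exact mul_le_mul (hC p) (hD p) (apply_nonneg p.toSeminorm b)
      ((apply_nonneg p.toSeminorm a).trans (hC p))
  | hadd a b ha hb =>
    obtain ⟨C, hC⟩ := ha
    obtain ⟨D, hD⟩ := hb
    exact ⟨C + D, fun p => (map_add_le_add p.toSeminorm a b).trans (add_le_add (hC p) (hD p))⟩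

/-- The largest C*-seminorm on the algebraic CAR algebra: the supremum of all C*-seminorms. -/
noncomputable def maxNorm (a : AlgCAR K) : ℝ :=
  ⨆ p : CStarSeminorm (AlgCAR K), p.toSeminorm a

instance : Nonempty (CStarSeminorm (AlgCAR K)) :=
  ⟨{ (0 : Seminorm ℂ (AlgCAR K)) with
      mul_le' := fun _ _ => by change (0 : ℝ) ≤ 0 * 0; simp
      star_mul_self' := fun _ => by change (0 : ℝ) = 0 * 0; simp }⟩

theorem le_maxNorm (p : CStarSeminorm (AlgCAR K)) (a : AlgCAR K) :
    p.toSeminorm a ≤ maxNorm a := by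
  obtain ⟨C, hC⟩ := exists_seminorm_bound a
  exact le_ciSup (f := fun p : CStarSeminorm (AlgCAR K) => p.toSeminorm a)
    ⟨C, by rintro _ ⟨p, rfl⟩; exact hC p⟩ p

theorem maxNorm_le {a : AlgCAR K} {C : ℝ}
    (h : ∀ p : CStarSeminorm (AlgCAR K), p.toSeminorm a ≤ C) : maxNorm a ≤ C :=
  ciSup_le h

theorem maxNorm_nonneg (a : AlgCAR K) : 0 ≤ maxNorm a :=
  Real.iSup_nonneg fun p => apply_nonneg p.toSeminorm a

/-- `maxNorm` as a seminorm. -/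
noncomputable def maxSeminorm : Seminorm ℂ (AlgCAR K) :=
  Seminorm.ofSMulLE maxNorm
    (le_antisymm (maxNorm_le fun p => (map_zero p.toSeminorm).le) (maxNorm_nonneg 0))
    (fun a b => maxNorm_le fun p => (map_add_le_add p.toSeminorm a b).trans
      (add_le_add (le_maxNorm p a) (le_maxNorm p b)))
    (fun c a => maxNorm_le fun p => by
      rw [map_smul_eq_mul]
      exact mul_le_mul_of_nonneg_left (le_maxNorm p a) (norm_nonneg c))

theorem maxNorm_mul_le (a b : AlgCAR K) : maxNorm (a * b) ≤ maxNorm a * maxNorm b :=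
  maxNorm_le fun p => (p.mul_le' a b).trans
    (mul_le_mul (le_maxNorm p a) (le_maxNorm p b) (apply_nonneg p.toSeminorm b)
      (maxNorm_nonneg a))

theorem mul_maxNorm_self_le (a : AlgCAR K) : maxNorm a * maxNorm a ≤ maxNorm (star a * a) := by
  have h : maxNorm a ≤ √(maxNorm (star a * a)) := maxNorm_le fun p => by
    apply Real.le_sqrt_of_sq_le
    rw [sq]
    exact (p.star_mul_self' a).symm.le.trans (le_maxNorm p _)
  calc maxNorm a * maxNorm a
      ≤ √(maxNorm (star a * a)) * √(maxNorm (star a * a)) :=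
        mul_le_mul h h (maxNorm_nonneg a) (Real.sqrt_nonneg _)
    _ = maxNorm (star a * a) := Real.mul_self_sqrt (maxNorm_nonneg _)

theorem maxNorm_le_star (a : AlgCAR K) : maxNorm a ≤ maxNorm (star a) := by
  have h := (mul_maxNorm_self_le a).trans (maxNorm_mul_le (star a) a)
  rcases (maxNorm_nonneg a).eq_or_lt with h0 | h0
  · rw [← h0]; exact maxNorm_nonneg _
  · exact le_of_mul_le_mul_right h h0

theorem maxNorm_star (a : AlgCAR K) : maxNorm (star a) = maxNorm a :=
  le_antisymm (by simpa using maxNorm_le_star (star a)) (maxNorm_le_star a)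

noncomputable instance instSeminormedRing : SeminormedRing (AlgCAR K) :=
  { (maxSeminorm (K := K)).toAddGroupSeminorm.toSeminormedAddGroup,
    instRing K with
    norm := maxNorm
    norm_mul_le := maxNorm_mul_le }

theorem norm_def (a : AlgCAR K) : ‖a‖ = maxNorm a := rfl

noncomputable instance instNormedAlgebra : NormedAlgebra ℂ (AlgCAR K) where
  norm_smul_le c a := (map_smul_eq_mul (maxSeminorm (K := K)) c a).le

instance instNormedStarGroup : NormedStarGroup (AlgCAR K) :=
  ⟨fun a => (maxNorm_star a).le⟩

theorem lift_norm_le {B : Type v} [CStarAlgebra B] (f : AlgCAR K →⋆ₐ[ℂ] B) (a : AlgCAR K) :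
    ‖f a‖ ≤ ‖a‖ :=
  le_maxNorm
    { (normSeminorm ℂ B).comp f.toAlgHom.toLinearMap with
      mul_le' := fun a b => by
        change ‖f (a * b)‖ ≤ ‖f a‖ * ‖f b‖
        rw [map_mul]; exact norm_mul_le _ _
      star_mul_self' := fun a => by
        change ‖f (star a * a)‖ = ‖f a‖ * ‖f a‖
        rw [map_mul, map_star]; exact CStarRing.norm_star_mul_self } a

end Norm

end AlgCAR

/-! ### The selfdual CAR algebra -/

/-- The selfdual CAR algebra over `K`: the universal C*-algebra generated by `1` and the elements
of `K` subject to `k* k' + k' k* = ⟨k, k'⟩ 1`, i.e. the Hausdorff completion of the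
algebraic CAR algebra in its largest C*-seminorm. -/
def CARAlgebra (K : Type u) [NormedAddCommGroup K] [InnerProductSpace ℂ K] [StarAddMonoid K]
    [StarModule ℂ K] : Type u :=
  UniformSpace.Completion (AlgCAR K)

namespace CARAlgebra

section Instances

variable (K : Type u) [NormedAddCommGroup K] [InnerProductSpace ℂ K] [StarAddMonoid K]
  [StarModule ℂ K]

noncomputable instance instNormedRing : NormedRing (CARAlgebra K) :=
  inferInstanceAs (NormedRing (UniformSpace.Completion (AlgCAR K)))

instance instCompleteSpace : CompleteSpace (CARAlgebra K) :=
  inferInstanceAs (CompleteSpace (UniformSpace.Completion (AlgCAR K)))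

noncomputable instance instNormedAlgebra : NormedAlgebra ℂ (CARAlgebra K) :=
  { (inferInstance : Algebra ℂ (UniformSpace.Completion (AlgCAR K))) with
    norm_smul_le := fun c a =>
      norm_smul_le (β := UniformSpace.Completion (AlgCAR K)) c a }

variable {K}

/-- The canonical map from the algebraic CAR algebra to its completion. -/
noncomputable def ofAlg : AlgCAR K →ₐ[ℂ] CARAlgebra K where
  toRingHom := UniformSpace.Completion.coeRingHom
  commutes' _ := rfl

theorem denseRange_ofAlg : DenseRange (ofAlg : AlgCAR K → CARAlgebra K) :=
  UniformSpace.Completion.denseRange_coe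

theorem continuous_ofAlg : Continuous (ofAlg : AlgCAR K → CARAlgebra K) :=
  UniformSpace.Completion.continuous_coe _

theorem norm_ofAlg (a : AlgCAR K) : ‖(ofAlg a : CARAlgebra K)‖ = ‖a‖ :=
  UniformSpace.Completion.norm_coe a

noncomputable instance instStar : Star (CARAlgebra K) :=
  ⟨UniformSpace.Completion.map (star : AlgCAR K → AlgCAR K)⟩

theorem continuous_star_aux : Continuous (star : CARAlgebra K → CARAlgebra K) :=
  UniformSpace.Completion.continuous_map

theorem star_ofAlg (a : AlgCAR K) : star (ofAlg a : CARAlgebra K) = ofAlg (star a) :=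
  UniformSpace.Completion.map_coe
    (AddMonoidHomClass.isometry_of_norm (starAddEquiv (R := AlgCAR K)) norm_star).uniformContinuous
    a

noncomputable instance instCStarAlgebra : CStarAlgebra (CARAlgebra K) :=
  { instNormedRing K, instCompleteSpace K, instNormedAlgebra K, instStar with
    star_involutive := fun a => denseRange_ofAlg.induction_on a
      (isClosed_eq (continuous_star_aux.comp continuous_star_aux) continuous_id)
      (fun a => by rw [star_ofAlg, star_ofAlg, star_star])
    star_mul := fun a b => denseRange_ofAlg.induction_on₂
      (p := fun a b : CARAlgebra K => star (a * b) = star b * star a)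
      (isClosed_eq (continuous_star_aux.comp (continuous_fst.mul continuous_snd))
        ((continuous_star_aux.comp continuous_snd).mul (continuous_star_aux.comp continuous_fst)))
      (fun a b => by rw [← map_mul, star_ofAlg, star_ofAlg, star_ofAlg, star_mul, map_mul]) a b
    star_add := fun a b => denseRange_ofAlg.induction_on₂
      (p := fun a b : CARAlgebra K => star (a + b) = star a + star b)
      (isClosed_eq (continuous_star_aux.comp (continuous_fst.add continuous_snd))
        ((continuous_star_aux.comp continuous_fst).add (continuous_star_aux.comp continuous_snd)))
      (fun a b => by rw [← map_add, star_ofAlg, star_ofAlg, star_ofAlg, star_add, map_add]) a b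
    star_smul := fun c a => denseRange_ofAlg.induction_on
      (p := fun a : CARAlgebra K => star (c • a) = star c • star a) a
      (isClosed_eq (continuous_star_aux.comp (continuous_const_smul c))
        (continuous_star_aux.const_smul (star c)))
      (fun a => by rw [← map_smul, star_ofAlg, star_ofAlg, star_smul, map_smul])
    norm_mul_self_le := fun a => denseRange_ofAlg.induction_on
      (p := fun a : CARAlgebra K => ‖a‖ * ‖a‖ ≤ ‖star a * a‖) a
      (isClosed_le (continuous_norm.mul continuous_norm)
        (continuous_norm.comp (continuous_star_aux.mul continuous_id)))
      (fun a => by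
        rw [star_ofAlg, ← map_mul, norm_ofAlg, norm_ofAlg]
        exact AlgCAR.mul_maxNorm_self_le a) }

variable (K) in
/-- The canonical map from `K` to the selfdual CAR algebra. -/
noncomputable def ι : K →ₗ[ℂ] CARAlgebra K := ofAlg.toLinearMap ∘ₗ AlgCAR.ι K

theorem isCARMap_ι : IsCARMap (ι K) where
  map_star k := by
    change ofAlg _ = star (ofAlg _)
    rw [star_ofAlg, AlgCAR.star_ι]
  anticomm k k' := by
    change star (ofAlg _) * ofAlg _ + ofAlg _ * star (ofAlg _) = _
    rw [star_ofAlg, AlgCAR.star_ι, ← map_mul ofAlg, ← map_mul ofAlg, ← map_add,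
      AlgCAR.ι_anticomm, map_smul, map_one]

theorem continuous_algLift {B : Type v} [CStarAlgebra B] (φ : K →ₗ[ℂ] B) (h : IsCARMap φ) :
    Continuous (AlgCAR.lift φ h) :=
  AddMonoidHomClass.continuous_of_bound (AlgCAR.lift φ h) 1 fun a => by
    rw [one_mul]; exact AlgCAR.lift_norm_le _ a

/-- The continuous extension of `AlgCAR.lift φ h`, as a ring homomorphism. -/
noncomputable def liftRingHom {B : Type v} [CStarAlgebra B] (φ : K →ₗ[ℂ] B) (h : IsCARMap φ) :
    CARAlgebra K →+* B :=
  UniformSpace.Completion.extensionHom (AlgCAR.lift φ h : AlgCAR K →+* B) (continuous_algLift φ h)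

theorem continuous_liftRingHom {B : Type v} [CStarAlgebra B] (φ : K →ₗ[ℂ] B) (h : IsCARMap φ) :
    Continuous (liftRingHom φ h) :=
  UniformSpace.Completion.continuous_extension

theorem liftRingHom_ofAlg {B : Type v} [CStarAlgebra B] (φ : K →ₗ[ℂ] B) (h : IsCARMap φ)
    (a : AlgCAR K) : liftRingHom φ h (ofAlg a) = AlgCAR.lift φ h a :=
  UniformSpace.Completion.extensionHom_coe (AlgCAR.lift φ h : AlgCAR K →+* B)
    (continuous_algLift φ h) a

/-- The universal property: a linear map from `K` to a C*-algebra which satisfies the CAR extends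
to a unital *-homomorphism. -/
noncomputable def lift {B : Type v} [CStarAlgebra B] (φ : K →ₗ[ℂ] B) (h : IsCARMap φ) :
    CARAlgebra K →⋆ₐ[ℂ] B :=
  { liftRingHom φ h with
    commutes' := fun c => by
      change liftRingHom φ h (algebraMap ℂ (CARAlgebra K) c) = _
      rw [← AlgHom.commutes (ofAlg (K := K)) c, liftRingHom_ofAlg]
      exact (AlgCAR.lift φ h).toAlgHom.commutes c
    map_star' := fun a => denseRange_ofAlg.induction_on
      (p := fun a : CARAlgebra K => liftRingHom φ h (star a) = star (liftRingHom φ h a)) a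
      (isClosed_eq ((continuous_liftRingHom φ h).comp continuous_star)
        (continuous_star.comp (continuous_liftRingHom φ h)))
      (fun a => by rw [star_ofAlg, liftRingHom_ofAlg, liftRingHom_ofAlg, map_star]) }

theorem lift_ofAlg {B : Type v} [CStarAlgebra B] (φ : K →ₗ[ℂ] B) (h : IsCARMap φ)
    (a : AlgCAR K) : lift φ h (ofAlg a) = AlgCAR.lift φ h a :=
  liftRingHom_ofAlg φ h a

theorem lift_ι {B : Type v} [CStarAlgebra B] (φ : K →ₗ[ℂ] B) (h : IsCARMap φ) (k : K) :
    lift φ h (ι K k) = φ k :=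
  (lift_ofAlg φ h (AlgCAR.ι K k)).trans (AlgCAR.lift_ι φ h k)

theorem continuous_starAlgHom {B : Type v} [CStarAlgebra B] (f : CARAlgebra K →⋆ₐ[ℂ] B) :
    Continuous f :=
  AddMonoidHomClass.continuous_of_bound f 1 fun a => by
    rw [one_mul]; exact NonUnitalStarAlgHom.norm_apply_le f a

/-- `CARAlgebra K` is generated by `K`: *-homomorphisms are determined by their values there. -/
theorem hom_ext {B : Type v} [CStarAlgebra B] {f g : CARAlgebra K →⋆ₐ[ℂ] B}
    (h : ∀ k, f (ι K k) = g (ι K k)) : f = g := by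
  ext a
  refine denseRange_ofAlg.induction_on a (isClosed_eq (continuous_starAlgHom f) (continuous_starAlgHom g)) ?_
  intro a
  induction a using AlgCAR.induction with
  | hc c => rw [AlgHom.commutes, AlgHomClass.commutes, AlgHomClass.commutes]
  | hι k => exact h k
  | hmul a b ha hb => rw [map_mul, map_mul, map_mul, ha, hb]
  | hadd a b ha hb => rw [map_add, map_add, map_add, ha, hb]

end Instances

end CARAlgebra

/-! ### Bogoliubov endomorphisms -/

/-- An isometry of `K` that commutes with the complex conjugation. -/
structure BogoliubovIsometry (K : Type u) [NormedAddCommGroup K] [InnerProductSpace ℂ K]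
    [StarAddMonoid K] extends K →ₗᵢ[ℂ] K where
  map_star' : ∀ k : K, toFun (star k) = star (toFun k)

namespace CARAlgebra

section Bogoliubov

variable {K : Type u} [NormedAddCommGroup K] [InnerProductSpace ℂ K] [StarAddMonoid K]
  [StarModule ℂ K]

theorem isCARMap_comp (V : BogoliubovIsometry K) :
    IsCARMap (ι K ∘ₗ V.toLinearIsometry.toLinearMap) where
  map_star k := (congrArg (ι K) (V.map_star' k)).trans (isCARMap_ι.map_star _)
  anticomm k k' := (isCARMap_ι.anticomm (V.toLinearIsometry k) (V.toLinearIsometry k')).trans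
    (by rw [V.toLinearIsometry.inner_map_map])

/-- The Bogoliubov endomorphism `ϱ_V` of the selfdual CAR algebra: the unital *-endomorphism
which extends `V`. -/
noncomputable def bogoliubov (V : BogoliubovIsometry K) : CARAlgebra K →⋆ₐ[ℂ] CARAlgebra K :=
  lift (ι K ∘ₗ V.toLinearIsometry.toLinearMap) (isCARMap_comp V)

theorem bogoliubov_ι (V : BogoliubovIsometry K) (k : K) :
    bogoliubov V (ι K k) = ι K (V.toLinearIsometry k) :=
  lift_ι _ _ k

variable (K) in
/-- The isometry `-1` of `K`. -/
noncomputable def negIsometry : BogoliubovIsometry K where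
  toLinearIsometry := (LinearIsometryEquiv.neg ℂ : K ≃ₗᵢ[ℂ] K).toLinearIsometry
  map_star' k := (star_neg k).symm

variable (K) in
/-- The even subalgebra: the fixed points of the automorphism `γ` that corresponds to `-1`. -/
noncomputable def evenSubalgebra : StarSubalgebra ℂ (CARAlgebra K) :=
  StarAlgHom.equalizer (bogoliubov (negIsometry K)) (StarAlgHom.id ℂ (CARAlgebra K))

end Bogoliubov

end CARAlgebra

/-- The index `dim ker T - dim ker T*` of a Fredholm operator `T` on a Hilbert space. -/
noncomputable def fredholmIndex {K : Type u} [NormedAddCommGroup K] [InnerProductSpace ℂ K]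
    [CompleteSpace K] (T : K →L[ℂ] K) : ℤ :=
  (Module.finrank ℂ T.ker : ℤ) - (Module.finrank ℂ (ContinuousLinearMap.adjoint T).ker : ℤ)

/-!
Write `κ` for the skew-adjoint unitary in the CAR algebra given by `k ∈ ker V*`; thus `κ² = -1`, so
that `w = (1 + κ) / √2` is unitary. As `k` is orthogonal to `ran V`, `κ` anticommutes with `Vx` for
every `x ∈ K`, and therefore `σ = w ϱ_V(·) w*` maps `x` to `κ V(x)` (`smul_one_add_conj`).

*Range.* The elements `κ V(x)` are even, hence so is `ran σ`. Since `ran σ` is normalized by `κ` (on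
`ran σ`, conjugation with `κ` is the grading automorphism transported by `σ`), `ran σ + κ ran σ` is
an algebra. It contains `κ` and `V(x) = -κ (κ V(x))`, and index `-1` says that `ker V*` is the line
through `k`, so it contains `K`, and thus a dense subalgebra. The projection `(1 + γ) / 2` onto the
even part sends it into `ran σ`, which is closed because `σ` is isometric once it is injective
(`range_eq_evenSubalgebra`).

*Injectivity.* It suffices that `ϱ_V` is injective. On `K = ran V ⊕ ℂ k` the map
`V(x) ↦ diag(x, -x)`, `k ↦ !![0, 1; -1, 0]` into the `2 × 2` matrices over the CAR algebra satisfies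
the CAR (`IsCARMap.comp_adj_add`). The induced *-homomorphism composed with `ϱ_V` is
`a ↦ diag(a, γ(a))`, which is injective (`bogoliubov_injective`). This avoids the simplicity of the
CAR algebra.
-/

/-! ### Complex conjugations and Bogoliubov isometries -/

/-- A complex conjugation is antiunitary, by polarization. -/
theorem inner_star_star {K : Type u} [NormedAddCommGroup K] [InnerProductSpace ℂ K]
    [StarAddMonoid K] [StarModule ℂ K] [NormedStarGroup K] (x y : K) :
    inner ℂ (star x) (star y) = inner ℂ y x := by
  have h1 : ‖star x + Complex.I • star y‖ = ‖x - Complex.I • y‖ := by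
    rw [← norm_star (x - Complex.I • y), star_sub, star_smul, Complex.star_def, Complex.conj_I,
      neg_smul, sub_neg_eq_add]
  have h2 : ‖star x - Complex.I • star y‖ = ‖x + Complex.I • y‖ := by
    rw [← norm_star (x + Complex.I • y), star_add, star_smul, Complex.star_def, Complex.conj_I,
      neg_smul, sub_eq_add_neg]
  rw [← inner_conj_symm y x, inner_eq_sum_norm_sq_div_four, inner_eq_sum_norm_sq_div_four,
    ← star_add, ← star_sub, norm_star, norm_star]
  simp only [RCLike.I_to_complex, h1, h2, map_div₀, map_add, map_sub, map_mul, map_pow]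
  simp only [Complex.coe_algebraMap, Complex.conj_ofReal, Complex.conj_I, map_ofNat]
  ring

theorem inner_star_right {K : Type u} [NormedAddCommGroup K] [InnerProductSpace ℂ K]
    [StarAddMonoid K] [StarModule ℂ K] [NormedStarGroup K] (x y : K) :
    inner ℂ x (star y) = inner ℂ y (star x) := by
  rw [← inner_star_star, star_star]

namespace BogoliubovIsometry

variable {K : Type u} [NormedAddCommGroup K] [InnerProductSpace ℂ K] [CompleteSpace K]
  [StarAddMonoid K]

/-- The adjoint of the isometry `V`. -/
noncomputable def adj (V : BogoliubovIsometry K) : K →L[ℂ] K :=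
  ContinuousLinearMap.adjoint V.toLinearIsometry.toContinuousLinearMap

theorem inner_adj_right (V : BogoliubovIsometry K) (x y : K) :
    inner ℂ x (V.adj y) = inner ℂ (V.toLinearIsometry x) y :=
  ContinuousLinearMap.adjoint_inner_right _ _ _

theorem adj_apply (V : BogoliubovIsometry K) (x : K) : V.adj (V.toLinearIsometry x) = x := by
  refine ext_inner_left ℂ fun y => ?_
  rw [inner_adj_right, V.toLinearIsometry.inner_map_map]

theorem adj_star [StarModule ℂ K] [NormedStarGroup K] (V : BogoliubovIsometry K) (y : K) :
    V.adj (star y) = star (V.adj y) := by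
  refine ext_inner_left ℂ fun x => ?_
  have hV : V.toLinearIsometry (star x) = star (V.toLinearIsometry x) := V.map_star' x
  rw [inner_adj_right, inner_star_right, ← hV, inner_star_right x, ← inner_conj_symm y,
    ← inner_adj_right, inner_conj_symm]

theorem inner_apply_of_mem_ker (V : BogoliubovIsometry K) {k : K} (hk : V.adj k = 0) (x : K) :
    inner ℂ k (V.toLinearIsometry x) = 0 := by
  rw [← inner_conj_symm, ← inner_adj_right, hk, inner_zero_right, map_zero]

/-- If `ker V*` is one-dimensional and `k ∈ ker V*` has `‖k‖² = 2`, then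
`1 = V V* + ½ ⟨k, ·⟩ k`. -/
theorem apply_adj_add (V : BogoliubovIsometry K) (hker : Module.finrank ℂ V.adj.ker = 1) {k : K}
    (hk : V.adj k = 0) (hkk : inner ℂ k k = (2 : ℂ)) (y : K) :
    V.toLinearIsometry (V.adj y) + (inner ℂ k y / 2 : ℂ) • k = y := by
  have hk0 : (⟨k, hk⟩ : V.adj.ker) ≠ 0 := by
    intro h
    rw [Subtype.ext_iff] at h
    change k = 0 at h
    rw [h, inner_zero_left] at hkk
    exact two_ne_zero hkk.symm
  have hy : V.adj (y - V.toLinearIsometry (V.adj y)) = 0 := by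
    rw [map_sub, adj_apply, sub_self]
  obtain ⟨c, hc⟩ := (finrank_eq_one_iff_of_nonzero' _ hk0).1 hker ⟨_, hy⟩
  have hc' : c • k = y - V.toLinearIsometry (V.adj y) := congrArg Subtype.val hc
  have hyk : inner ℂ k y = c * 2 := by
    rw [← hkk, ← inner_smul_right, hc', inner_sub_right, inner_apply_of_mem_ker V hk, sub_zero]
  rw [hyk, mul_div_cancel_right₀ c two_ne_zero, hc', add_sub_cancel]

end BogoliubovIsometry

/-- The kernel of an isometry is trivial, so index `-1` says that `ker V*` is a line. -/
theorem LinearIsometry.finrank_ker_adjoint_of_fredholmIndex {K : Type u} [NormedAddCommGroup K]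
    [InnerProductSpace ℂ K] [CompleteSpace K] (V : K →ₗᵢ[ℂ] K)
    (h : fredholmIndex V.toContinuousLinearMap = -1) :
    Module.finrank ℂ (ContinuousLinearMap.adjoint V.toContinuousLinearMap).ker = 1 := by
  have h0 : V.toContinuousLinearMap.ker = ⊥ := LinearMap.ker_eq_bot.2 V.injective
  rw [fredholmIndex, h0, finrank_bot] at h
  omega

/-! ### Injectivity of Bogoliubov endomorphisms -/

/-- A CAR map `φ`, composed with `V*`, extends from `ran V` to all of `K` by sending `k ∈ ker V*`
to a skew-adjoint unitary that anticommutes with the range of `φ`. -/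
theorem IsCARMap.comp_adj_add {K : Type u} [NormedAddCommGroup K] [InnerProductSpace ℂ K]
    [CompleteSpace K] [StarAddMonoid K] [StarModule ℂ K] [NormedStarGroup K]
    {B : Type v} [Ring B] [Algebra ℂ B] [StarRing B] [StarModule ℂ B]
    {φ : K →ₗ[ℂ] B} (hφ : IsCARMap φ) (V : BogoliubovIsometry K) {k : K}
    (hdec : ∀ y, V.toLinearIsometry (V.adj y) + (inner ℂ k y / 2 : ℂ) • k = y)
    (hks : star k = -k) {J : B} (hJs : star J = -J) (hJJ : J * J = -1)
    (hJφ : ∀ x, J * φ x = -(φ x * J)) :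
    IsCARMap (φ ∘ₗ V.adj.toLinearMap +
      ((2⁻¹ : ℂ) • (innerSL ℂ k).toLinearMap).smulRight J) := by
  have happ : ∀ y, (φ ∘ₗ V.adj.toLinearMap +
      ((2⁻¹ : ℂ) • (innerSL ℂ k).toLinearMap).smulRight J) y =
        φ (V.adj y) + (inner ℂ k y / 2 : ℂ) • J := by
    intro y
    simp [div_eq_inv_mul]
  constructor
  · intro y
    have hin : inner ℂ k (star y) = -(starRingEnd ℂ) (inner ℂ k y) := by
      rw [inner_star_right, hks, inner_neg_right, inner_conj_symm]
    rw [happ, happ, V.adj_star, hφ.map_star, star_add, star_smul, hJs, hin]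
    simp [neg_div]
  · intro x y
    have hxy : inner ℂ x y =
        inner ℂ (V.adj x) (V.adj y) + (starRingEnd ℂ) (inner ℂ k x) * inner ℂ k y / 2 := by
      conv_lhs => rw [← hdec y]
      rw [inner_add_right, inner_smul_right, ← inner_conj_symm x (V.toLinearIsometry _),
        ← V.inner_adj_right, inner_conj_symm, inner_conj_symm]
      ring
    have h1 := hφ.anticomm (V.adj x) (V.adj y)
    have h2 := hJφ (star (V.adj x))
    rw [hφ.map_star] at h2
    rw [happ, happ, star_add, star_smul, hJs, hxy, add_smul, ← h1]
    simp only [add_mul, mul_add, smul_mul_assoc, mul_smul_comm, neg_mul, mul_neg, hJJ, h2,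
      hJφ (V.adj y), smul_neg, neg_neg]
    simp only [Complex.star_def, map_div₀, map_ofNat]
    module

namespace CARAlgebra

section Algebra

variable {K : Type u} [NormedAddCommGroup K] [InnerProductSpace ℂ K] [StarAddMonoid K]
  [StarModule ℂ K]

theorem bogoliubov_neg_ι (x : K) : bogoliubov (negIsometry K) (ι K x) = -ι K x := by
  rw [bogoliubov_ι]
  exact map_neg (ι K) x

theorem bogoliubov_neg_bogoliubov_neg (a : CARAlgebra K) :
    bogoliubov (negIsometry K) (bogoliubov (negIsometry K) a) = a := by
  have h : (bogoliubov (negIsometry K)).comp (bogoliubov (negIsometry K)) =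
      StarAlgHom.id ℂ (CARAlgebra K) := hom_ext fun x => by
    simp [bogoliubov_neg_ι]
  exact DFunLike.congr_fun h a

variable (K) in
/-- The unital *-homomorphism `a ↦ diag(a, γ(a))` into the `2 × 2` matrices over the CAR
algebra. -/
noncomputable def diagGrading :
    CARAlgebra K →⋆ₐ[ℂ] CStarMatrix (Fin 2) (Fin 2) (CARAlgebra K) where
  toFun a := CStarMatrix.ofMatrix !![a, 0; 0, bogoliubov (negIsometry K) a]
  map_one' := by
    ext i j
    fin_cases i <;> fin_cases j <;> simp [CStarMatrix.ofMatrix_apply]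
  map_mul' a b := by
    ext i j
    fin_cases i <;> fin_cases j <;>
      simp [CStarMatrix.mul_apply, CStarMatrix.ofMatrix_apply, Fin.sum_univ_two]
  map_zero' := by
    ext i j
    fin_cases i <;> fin_cases j <;> simp [CStarMatrix.ofMatrix_apply]
  map_add' a b := by
    ext i j
    fin_cases i <;> fin_cases j <;> simp [CStarMatrix.ofMatrix_apply]
  commutes' c := by
    ext i j
    fin_cases i <;> fin_cases j <;>
      simp [CStarMatrix.algebraMap_apply, CStarMatrix.ofMatrix_apply, AlgHomClass.commutes]
  map_star' a := by
    ext i j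
    fin_cases i <;> fin_cases j <;>
      simp [CStarMatrix.star_apply, CStarMatrix.ofMatrix_apply, map_star]

theorem diagGrading_injective : Function.Injective (diagGrading K) := fun _ _ h =>
  congrArg (fun M : CStarMatrix (Fin 2) (Fin 2) (CARAlgebra K) => M 0 0) h

/-- In a nonzero CAR algebra, the canonical map `K → CARAlgebra K` is injective. -/
theorem eq_zero_of_ι_eq_zero [Nontrivial (CARAlgebra K)] {x : K} (h : ι K x = 0) : x = 0 := by
  have h1 := isCARMap_ι.anticomm x x
  rw [h, star_zero, mul_zero, add_zero] at h1
  exact inner_self_eq_zero.1 ((smul_eq_zero.1 h1.symm).resolve_right one_ne_zero)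

theorem inner_self_of_ι_mem_unitary [Nontrivial (CARAlgebra K)] {k : K}
    (h : ι K k ∈ unitary (CARAlgebra K)) : inner ℂ k k = (2 : ℂ) := by
  have h1 := isCARMap_ι.anticomm k k
  rw [Unitary.star_mul_self_of_mem h, Unitary.mul_star_self_of_mem h, ← two_smul ℂ] at h1
  exact (smul_left_injective ℂ (one_ne_zero (α := CARAlgebra K)) h1).symm

theorem star_eq_neg_of_ι_mem_skewAdjoint [Nontrivial (CARAlgebra K)] {k : K}
    (h : ι K k ∈ skewAdjoint (CARAlgebra K)) : star k = -k := by
  refine eq_neg_of_add_eq_zero_left (eq_zero_of_ι_eq_zero ?_)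
  rw [map_add, isCARMap_ι.map_star, skewAdjoint.mem_iff.1 h, neg_add_cancel]

/-- If `k` spans `ker V*` then `ϱ_V` is injective: the *-homomorphism into `M₂` that restricts to
`Vx ↦ diag(x, -x)` on `ran V` and maps `k` to a rotation by a right angle composes with `ϱ_V`
to the injective map `a ↦ diag(a, γ(a))`. -/
theorem bogoliubov_injective [CompleteSpace K] [NormedStarGroup K] (V : BogoliubovIsometry K)
    {k : K} (hk : V.adj k = 0)
    (hdec : ∀ y, V.toLinearIsometry (V.adj y) + (inner ℂ k y / 2 : ℂ) • k = y)
    (hks : star k = -k) : Function.Injective (bogoliubov V) := by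
  let : PartialOrder (CARAlgebra K) := CStarAlgebra.spectralOrder _
  let : StarOrderedRing (CARAlgebra K) := CStarAlgebra.spectralOrderedRing _
  set J : CStarMatrix (Fin 2) (Fin 2) (CARAlgebra K) := CStarMatrix.ofMatrix !![0, 1; -1, 0]
    with hJ
  have hφ : IsCARMap ((diagGrading K).toAlgHom.toLinearMap ∘ₗ ι K) :=
    { map_star := fun x => (congrArg _ (isCARMap_ι.map_star x)).trans (map_star (diagGrading K) _)
      anticomm := fun x y => by
        change star (diagGrading K (ι K x)) * diagGrading K (ι K y) +
          diagGrading K (ι K y) * star (diagGrading K (ι K x)) = _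
        rw [← map_star, ← map_mul, ← map_mul, ← map_add, isCARMap_ι.anticomm, map_smul, map_one] }
  have hJs : star J = -J := by
    ext i j
    fin_cases i <;> fin_cases j <;> simp [hJ, CStarMatrix.star_apply, CStarMatrix.ofMatrix_apply]
  have hJJ : J * J = -1 := by
    ext i j
    fin_cases i <;> fin_cases j <;>
      simp [hJ, CStarMatrix.mul_apply, CStarMatrix.ofMatrix_apply,
        Fin.sum_univ_two]
  have hJφ : ∀ x, J * ((diagGrading K).toAlgHom.toLinearMap ∘ₗ ι K) x =
      -(((diagGrading K).toAlgHom.toLinearMap ∘ₗ ι K) x * J) := by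
    intro x
    change J * CStarMatrix.ofMatrix !![ι K x, 0; 0, bogoliubov (negIsometry K) (ι K x)] =
      -(CStarMatrix.ofMatrix !![ι K x, 0; 0, bogoliubov (negIsometry K) (ι K x)] * J)
    ext i j
    fin_cases i <;> fin_cases j <;>
      simp [hJ, CStarMatrix.mul_apply, CStarMatrix.ofMatrix_apply, Fin.sum_univ_two,
        bogoliubov_neg_ι]
  have hcomp : (lift _ (hφ.comp_adj_add V hdec hks hJs hJJ hJφ)).comp (bogoliubov V) =
      diagGrading K := hom_ext fun x => by
    rw [StarAlgHom.comp_apply, bogoliubov_ι, lift_ι]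
    simp [V.adj_apply, V.inner_apply_of_mem_ker hk]
  intro a b hab
  apply diagGrading_injective
  rw [← hcomp, StarAlgHom.comp_apply, StarAlgHom.comp_apply, hab]

end Algebra

/-! ### The twisted endomorphism and its range -/

section Twist

theorem smul_one_add_mem_unitary {A : Type v} [Ring A] [Algebra ℂ A] [StarRing A]
    [StarModule ℂ A] {u : A} (hu : u ∈ unitary A) (hs : star u = -u) :
    ((1 / √2 : ℝ) : ℂ) • (1 + u) ∈ unitary A := by
  have h2 : ((1 / √2 : ℝ) : ℂ) * ((1 / √2 : ℝ) : ℂ) = 2⁻¹ := by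
    rw [← Complex.ofReal_mul, ← sq, div_pow, Real.sq_sqrt zero_le_two]
    norm_num
  have huu : u * u = -1 := by
    rw [← Unitary.star_mul_self_of_mem hu, hs, neg_mul, neg_neg]
  have h : star (((1 / √2 : ℝ) : ℂ) • (1 + u)) = ((1 / √2 : ℝ) : ℂ) • (1 - u) := by
    rw [star_smul, Complex.star_def, Complex.conj_ofReal, star_add, star_one, hs, ← sub_eq_add_neg]
  have h3 : (2⁻¹ : ℂ) • (2 : A) = 1 := by
    rw [← map_ofNat (algebraMap ℂ A) 2, Algebra.algebraMap_eq_smul_one, smul_smul]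
    norm_num
  rw [Unitary.mem_iff, h]
  simp only [smul_mul_smul_comm, h2]
  constructor
  · rw [show (1 - u) * (1 + u) = 1 - u * u by noncomm_ring, huu, sub_neg_eq_add, one_add_one_eq_two,
      h3]
  · rw [show (1 + u) * (1 - u) = 1 - u * u by noncomm_ring, huu, sub_neg_eq_add, one_add_one_eq_two,
      h3]

/-- If `u` is a skew-adjoint unitary that anticommutes with `v`, conjugating `v` with
`(1 + u) / √2` gives `u v`. -/
theorem smul_one_add_conj {A : Type v} [Ring A] [Algebra ℂ A] [StarRing A]
    [StarModule ℂ A] {u v : A} (hu : u ∈ unitary A) (hs : star u = -u) (huv : u * v = -(v * u)) :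
    (((1 / √2 : ℝ) : ℂ) • (1 + u)) * v * star (((1 / √2 : ℝ) : ℂ) • (1 + u)) = u * v := by
  have hw := Unitary.mul_star_self_of_mem (smul_one_add_mem_unitary hu hs)
  have huu : u * u = -1 := by
    rw [← Unitary.star_mul_self_of_mem hu, hs, neg_mul, neg_neg]
  -- both sides equal `v (1 - u)`
  have h : (1 + u) * v = u * v * (1 + u) := by
    rw [add_mul, one_mul, mul_add, mul_one, mul_assoc, ← neg_eq_iff_eq_neg.2 huv, mul_neg,
      ← mul_assoc, huu, neg_mul, neg_neg, one_mul, add_comm]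
  rw [smul_mul_assoc, h, ← mul_smul_comm, mul_assoc, hw, mul_one]

variable {K : Type u} [NormedAddCommGroup K] [InnerProductSpace ℂ K] [StarAddMonoid K]
  [StarModule ℂ K]

/-- Let `k` be a skew-adjoint unitary spanning a complement of `ran V` and anticommuting with it. An
injective *-endomorphism `σ` with `σ(x) = k V(x)` for `x ∈ K` has range the even subalgebra.
Indeed the algebra generated by `K` is contained in `ran σ + k ran σ`; the first summand is even,
the second is odd. -/
theorem range_eq_evenSubalgebra (σ : CARAlgebra K →⋆ₐ[ℂ] CARAlgebra K)
    (hinj : Function.Injective σ) (V : BogoliubovIsometry K) {k : K}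
    (hku : ι K k ∈ unitary (CARAlgebra K)) (hks : star (ι K k) = -ι K k)
    (hkV : ∀ x, ι K k * ι K (V.toLinearIsometry x) = -(ι K (V.toLinearIsometry x) * ι K k))
    (hdec : ∀ y, ∃ x, ∃ c : ℂ, V.toLinearIsometry x + c • k = y)
    (hσ : ∀ x, σ (ι K x) = ι K k * ι K (V.toLinearIsometry x)) :
    σ.range = evenSubalgebra K := by
  have hkk : ι K k * ι K k = -1 := by
    rw [← Unitary.star_mul_self_of_mem hku, hks, neg_mul, neg_neg]
  have heven : ∀ a, bogoliubov (negIsometry K) (σ a) = σ a := by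
    have h : (bogoliubov (negIsometry K)).comp σ = σ := hom_ext fun x => by
      rw [StarAlgHom.comp_apply, hσ, map_mul, bogoliubov_neg_ι, bogoliubov_neg_ι, neg_mul_neg]
    exact DFunLike.congr_fun h
  -- conjugation with `k` corresponds under `σ` to the grading automorphism
  have hcomm : ∀ a, σ a * ι K k = ι K k * σ (bogoliubov (negIsometry K) a) := by
    intro a
    have h : (Unitary.conjStarAlgAut ℂ (CARAlgebra K) (star ⟨ι K k, hku⟩) :
        CARAlgebra K →⋆ₐ[ℂ] CARAlgebra K).comp σ = σ.comp (bogoliubov (negIsometry K)) :=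
      hom_ext fun x => by
        change Unitary.conjStarAlgAut ℂ (CARAlgebra K) (star ⟨ι K k, hku⟩) (σ (ι K x)) =
          σ (bogoliubov (negIsometry K) (ι K x))
        rw [Unitary.conjStarAlgAut_apply, bogoliubov_neg_ι, map_neg, hσ]
        change star (ι K k) * (ι K k * _) * star (star (ι K k)) = _
        rw [star_star, ← mul_assoc, Unitary.star_mul_self_of_mem hku, one_mul, hkV, neg_neg]
    have h1 := DFunLike.congr_fun h a
    change Unitary.conjStarAlgAut ℂ (CARAlgebra K) (star ⟨ι K k, hku⟩) (σ a) =
      σ (bogoliubov (negIsometry K) a) at h1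
    rw [Unitary.conjStarAlgAut_apply] at h1
    change star (ι K k) * σ a * star (star (ι K k)) = _ at h1
    rw [← h1, star_star, ← mul_assoc, ← mul_assoc, Unitary.mul_star_self_of_mem hku, one_mul]
  have hsum : ∀ b : AlgCAR K, ∃ r s, ofAlg b = σ r + ι K k * σ s := by
    intro b
    induction b using AlgCAR.induction with
    | hc c =>
      exact ⟨algebraMap ℂ _ c, 0, by
        rw [AlgHom.commutes, AlgHomClass.commutes, map_zero, mul_zero, add_zero]⟩
    | hι y =>
      obtain ⟨x, c, rfl⟩ := hdec y
      refine ⟨0, c • 1 - ι K x, ?_⟩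
      change ι K _ = _
      rw [map_zero, zero_add, map_sub, map_smul, map_one, hσ, mul_sub, ← mul_assoc, hkk, map_add,
        map_smul, neg_one_mul, sub_neg_eq_add, mul_smul_comm, mul_one, add_comm]
    | hmul a b ha hb =>
      obtain ⟨r, s, ha⟩ := ha
      obtain ⟨r', s', hb⟩ := hb
      refine ⟨r * r' - bogoliubov (negIsometry K) s * s',
        s * r' + bogoliubov (negIsometry K) r * s', ?_⟩
      have h1 : σ r * (ι K k * σ s') = ι K k * (σ (bogoliubov (negIsometry K) r) * σ s') := by
        rw [← mul_assoc, hcomm, mul_assoc]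
      have h2 : ι K k * σ s * (ι K k * σ s') = -(σ (bogoliubov (negIsometry K) s) * σ s') := by
        rw [mul_assoc, ← mul_assoc (σ s), hcomm, mul_assoc, ← mul_assoc (ι K k), hkk, neg_one_mul]
      rw [map_mul, ha, hb, add_mul, mul_add, mul_add, h1, h2]
      simp only [map_sub, map_add, map_mul, mul_add, mul_assoc]
      abel
    | hadd a b ha hb =>
      obtain ⟨r, s, ha⟩ := ha
      obtain ⟨r', s', hb⟩ := hb
      exact ⟨r + r', s + s', by rw [map_add, ha, hb, map_add, map_add, mul_add, add_add_add_comm]⟩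
  have hclosed : IsClosed (Set.range σ) :=
    (NonUnitalStarAlgHom.isometry σ hinj).isClosedEmbedding.isClosed_range
  have hproj : ∀ a, a + bogoliubov (negIsometry K) a ∈ Set.range σ := by
    intro a
    refine denseRange_ofAlg.induction_on
      (p := fun a => a + bogoliubov (negIsometry K) a ∈ Set.range σ) a
      (hclosed.preimage (continuous_id.add (continuous_starAlgHom _))) fun b => ?_
    obtain ⟨r, s, h⟩ := hsum b
    refine ⟨r + r, ?_⟩
    rw [h, map_add, map_add, map_mul, heven, heven, bogoliubov_neg_ι, neg_mul]
    abel
  ext a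
  constructor
  · rintro ⟨b, rfl⟩
    exact (StarAlgHom.mem_equalizer _ _ _).2 (heven b)
  · intro ha
    have ha' : bogoliubov (negIsometry K) a = a := (StarAlgHom.mem_equalizer _ _ _).1 ha
    obtain ⟨b, hb⟩ := hproj a
    refine ⟨(2⁻¹ : ℂ) • b, ?_⟩
    change σ ((2⁻¹ : ℂ) • b) = a
    rw [map_smul, hb, ha', ← two_smul ℂ, smul_smul, inv_mul_cancel₀ two_ne_zero, one_smul]

end Twist

end CARAlgebra

theorem mainTheorem1 {K : Type u} [NormedAddCommGroup K] [InnerProductSpace ℂ K] [CompleteSpace K]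
    [TopologicalSpace.SeparableSpace K] (hdim : ¬ FiniteDimensional ℂ K)
    [StarAddMonoid K] [StarModule ℂ K] [NormedStarGroup K]
    (V : BogoliubovIsometry K)
    (hV : ContinuousLinearMap.IsFredholm V.toLinearIsometry.toContinuousLinearMap)
    (hind : fredholmIndex V.toLinearIsometry.toContinuousLinearMap = -1)
    (k : K)
    (hk : k ∈ (ContinuousLinearMap.adjoint V.toLinearIsometry.toContinuousLinearMap).ker)
    (hk_unitary : CARAlgebra.ι K k ∈ unitary (CARAlgebra K))
    (hk_skew : CARAlgebra.ι K k ∈ skewAdjoint (CARAlgebra K))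
    (w : CARAlgebra K)
    (hw : w = ((1 / √2 : ℝ) : ℂ) • (1 + CARAlgebra.ι K k)) :
    w ∈ unitary (CARAlgebra K) ∧
      ∃ σ : CARAlgebra K ≃⋆ₐ[ℂ] CARAlgebra.evenSubalgebra K,
        σ 1 = 1 ∧
        ∀ a : CARAlgebra K,
          (σ a : CARAlgebra K) = w * CARAlgebra.bogoliubov V a * star w := by
  have hs : star (CARAlgebra.ι K k) = -CARAlgebra.ι K k := skewAdjoint.mem_iff.1 hk_skew
  have hw_unitary : w ∈ unitary (CARAlgebra K) := by
    rw [hw]; exact CARAlgebra.smul_one_add_mem_unitary hk_unitary hs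
  refine ⟨hw_unitary, ?_⟩
  have hk0 : V.adj k = 0 := hk
  have hker : Module.finrank ℂ V.adj.ker = 1 :=
    V.toLinearIsometry.finrank_ker_adjoint_of_fredholmIndex hind
  let σ : CARAlgebra K →⋆ₐ[ℂ] CARAlgebra K :=
    (Unitary.conjStarAlgAut ℂ (CARAlgebra K) ⟨w, hw_unitary⟩ :
      CARAlgebra K →⋆ₐ[ℂ] CARAlgebra K).comp (CARAlgebra.bogoliubov V)
  have hσ_apply : ∀ a, σ a = w * CARAlgebra.bogoliubov V a * star w := fun a =>
    Unitary.conjStarAlgAut_apply (S := ℂ) ⟨w, hw_unitary⟩ (CARAlgebra.bogoliubov V a)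
  suffices h : Function.Injective σ ∧ σ.range = CARAlgebra.evenSubalgebra K by
    obtain ⟨hinj, hrange⟩ := h
    have hmem : ∀ a, σ a ∈ CARAlgebra.evenSubalgebra K := fun a => hrange ▸ ⟨a, rfl⟩
    refine ⟨StarAlgEquiv.ofBijective (σ.codRestrict _ hmem) ⟨?_, ?_⟩, ?_, hσ_apply⟩
    · exact fun a b hab => hinj (congrArg Subtype.val hab)
    · rintro ⟨b, hb⟩
      rw [← hrange] at hb
      obtain ⟨a, ha⟩ := hb
      exact ⟨a, Subtype.ext ha⟩
    · exact map_one (σ.codRestrict _ hmem)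
  -- `1 ≠ 0` is what makes `ι` injective, and so turns properties of `ι k` into properties of `k`
  rcases subsingleton_or_nontrivial (CARAlgebra K) with hsub | hnontriv
  · exact ⟨Function.injective_of_subsingleton _, by
      ext a; rw [Subsingleton.elim a 0]; exact iff_of_true (zero_mem _) (zero_mem _)⟩
  have hdec := V.apply_adj_add hker hk0 (CARAlgebra.inner_self_of_ι_mem_unitary hk_unitary)
  have hkV : ∀ x, CARAlgebra.ι K k * CARAlgebra.ι K (V.toLinearIsometry x) =
      -(CARAlgebra.ι K (V.toLinearIsometry x) * CARAlgebra.ι K k) := by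
    intro x
    have h := CARAlgebra.isCARMap_ι.anticomm k (V.toLinearIsometry x)
    rw [V.inner_apply_of_mem_ker hk0, zero_smul, hs, neg_mul, mul_neg, ← neg_add,
      neg_eq_zero] at h
    exact eq_neg_of_add_eq_zero_left h
  have hinj : Function.Injective σ :=
    (Unitary.conjStarAlgAut ℂ (CARAlgebra K) ⟨w, hw_unitary⟩).injective.comp
      (CARAlgebra.bogoliubov_injective V hk0 hdec
        (CARAlgebra.star_eq_neg_of_ι_mem_skewAdjoint hk_skew))
  refine ⟨hinj, CARAlgebra.range_eq_evenSubalgebra σ hinj V hk_unitary hs hkV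
    (fun y => ⟨_, _, hdec y⟩) fun x => ?_⟩
  rw [hσ_apply, CARAlgebra.bogoliubov_ι, hw]
  exact CARAlgebra.smul_one_add_conj hk_unitary hs (hkV x)
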